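/- Let $\mathcal{AT}((k))$ be the infinite antitree with generations $V_1,V_2,V_3,\dots$, $|V_k|=k$: the simple graph with vertex set $V=\bigsqcup_{k\ge 1}V_k$ in which two distinct vertices are adjacent if and only if they lie in the same generation or in consecutive generations. For a vertex measure $\mu:V\to(0,\infty)$ and $f,g:V\to\mathbb{R}$ put $$\Delta f(x)=\frac{1}{\mu(x)}\sum_{y\sim x}(f(y)-f(x)),\qquad \Gamma(f,g)=\tfrac12\big(\Delta(fg)-f\Delta g-g\Delta f\big),$$ $$\Gamma_2(f,g)=\tfrac12\big(\Delta\Gamma(f,g)-\Gamma(f,\Delta g)-\Gamma(g,\Delta f)\big).$$ For $K\in\mathbb{R}$ and $x\in V$, the condition $CD(K,\infty,x)$ means that $\Gamma_2(f,f)(x)\ge K\,\Gamma(f,f)(x)$ for all $f:V\to\mathbb{R}$. **Theorem.** Let $\mu\equiv 1$ (the non-normalized setting) or $\mu(x)=d_x$, the degree of $x$ (the normalized setting). Then: 1. There are constants $K_x>0$ $(x\in V)$, depending only on the generation of $x$, such that $\mathcal{AT}((k))$ satisfies $CD(K_x,\infty,x)$ for every vertex $x$. 2. For every family of constants $K_x>0$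 $(x\in V)$ such that $\mathcal{AT}((k))$ satisfies $CD(K_x,\infty,x)$ for every vertex $x$, one has $$\liminf_{k\to\infty,\ x\in V_k}K_x=0.$$ -/

import Mathlib

namespace SimpleGraph

section BakryEmery

variable {V : Type*} (G : SimpleGraph V) [G.LocallyFinite] (μ : V → ℝ)

/-- The vertex measure of the non-normalized setting, `μ ≡ 1`. -/
def nonNormalizedMeasure (_G : SimpleGraph V) : V → ℝ := fun _ => 1

/-- The vertex measure of the normalized setting, `μ(x) = d_x`. -/
def normalizedMeasure : V → ℝ := fun x => (G.degree x : ℝ)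

/-- The graph Laplacian `Δ f(x) = (1 / μ(x)) ∑_{y ∼ x} (f(y) - f(x))`. -/
noncomputable def laplacian (f : V → ℝ) (x : V) : ℝ :=
  (1 / μ x) * ∑ y ∈ G.neighborFinset x, (f y - f x)

/-- The carré du champ `Γ(f,g) = ½ (Δ(fg) - f Δg - g Δf)`. -/
noncomputable def carreDuChamp (f g : V → ℝ) (x : V) : ℝ :=
  (1 / 2) * (G.laplacian μ (fun z => f z * g z) x
    - f x * G.laplacian μ g x - g x * G.laplacian μ f x)

/-- The iterated operator `Γ₂(f,g) = ½ (Δ Γ(f,g) - Γ(f,Δg) - Γ(g,Δf))`. -/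
noncomputable def carreDuChampTwo (f g : V → ℝ) (x : V) : ℝ :=
  (1 / 2) * (G.laplacian μ (G.carreDuChamp μ f g) x
    - G.carreDuChamp μ f (G.laplacian μ g) x
    - G.carreDuChamp μ g (G.laplacian μ f) x)

/-- The pointwise curvature-dimension condition `CD(K,N,x)` for `K ∈ ℝ` and `N ∈ (0,∞]`:
`Γ₂(f)(x) ≥ K Γ(f)(x) + (1/N) (Δf(x))²` for all `f : V → ℝ`. For `N = ∞` (that is, `⊤`)
the last term is zero. -/
def CurvatureDimensionAt (K : ℝ) (N : ENNReal) (x : V) : Prop :=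
  ∀ f : V → ℝ,
    K * G.carreDuChamp μ f f x + (N⁻¹).toReal * (G.laplacian μ f x) ^ 2
      ≤ G.carreDuChampTwo μ f f x

end BakryEmery

end SimpleGraph

namespace Antitree

/-- The vertices of the infinite antitree of a sequence `(a_k)_{k ≥ 1}`: a vertex is a pair
`⟨i, j⟩`, where `i + 1` is its generation and `j` is one of the `a_{i+1}` labels of that
generation (so the value `a 0` plays no role). -/
def Vertex (a : ℕ → ℕ) : Type := Σ i : ℕ, Fin (a (i + 1))

/-- The generation of a vertex, counted from `1`: `x ∈ V_k` if and only if
`generation a x = k`. -/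
def generation (a : ℕ → ℕ) (x : Vertex a) : ℕ := x.1 + 1

/-- The infinite antitree `𝒜𝒯((a_k))` with complete generations: two distinct vertices are
adjacent if and only if they lie in the same generation or in consecutive generations. -/
def graph (a : ℕ → ℕ) : SimpleGraph (Vertex a) where
  Adj x y := x ≠ y ∧ generation a x ≤ generation a y + 1 ∧ generation a y ≤ generation a x + 1
  symm := ⟨fun _ _ h => ⟨h.1.symm, h.2.2, h.2.1⟩⟩
  loopless := ⟨fun _ h => h.1 rfl⟩

theorem finite_neighborSet (a : ℕ → ℕ) (x : Vertex a) : ((graph a).neighborSet x).Finite := by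
  have h : (Set.range fun p : (Σ i : Fin (x.1 + 2), Fin (a ((i : ℕ) + 1))) =>
      (⟨(p.1 : ℕ), p.2⟩ : Vertex a)).Finite := Set.finite_range _
  refine h.subset ?_
  rintro ⟨i, j⟩ hy
  have hi : i + 1 ≤ x.1 + 1 + 1 := hy.2.2
  exact ⟨⟨⟨i, by omega⟩, j⟩, rfl⟩

noncomputable instance (a : ℕ → ℕ) : (graph a).LocallyFinite :=
  fun x => (finite_neighborSet a x).fintype

end Antitree

/-- The infinite antitree `𝒜𝒯((k))`, whose `k`-th generation has exactly `k` vertices. -/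
abbrev linearAntitree : SimpleGraph (Antitree.Vertex fun k => k) :=
  Antitree.graph fun k => k

/-! ### Increment formulas for Γ and Γ₂ on a general graph. -/

namespace SimpleGraph

section BakryEmery

variable {V : Type*} (G : SimpleGraph V) [G.LocallyFinite] (μ : V → ℝ)

/-! Since adjacency and `μ` see only generations, Γ and Γ₂ at `x` depend on `f` only through the
sums `s j` and square sums `t j` of the increments `f y - f x` over the generations within distance
two (`carreDuChampTwo_linearAntitree`).

For positivity, each `t j` is bounded below using `∑ (g - c)² ≥ 0`. In the two outer generations `c`
is chosen to absorb the cross terms; in the three middle ones the choice gives Cauchy–Schwarz. What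
remains is a ternary quadratic form in the three middle sums, and its principal minors are positive
for both measures. Strict positivity leaves room for a term `ε (t₁ + t₂ + t₃)`, which is a multiple
of Γ (`hasFormBound_of_minors`). The root generation is a separate small computation
(`curvatureDimensionAt_one`).

For decay, the test function is the generation itself. At generation `k ≥ 2` it has Γ = k/μ, while
Γ₂ ≤ 1/μ because the leading terms cancel. Hence K ≤ 1/k
(`le_inv_generation_of_curvatureDimensionAt`). -/

theorem carreDuChamp_eq_sum (f g : V → ℝ) (x : V) :
    G.carreDuChamp μ f g x
      = (1 / 2) * (1 / μ x * ∑ y ∈ G.neighborFinset x, (f y - f x) * (g y - g x)) := by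
  have h : ∑ y ∈ G.neighborFinset x, (f y - f x) * (g y - g x)
      = ∑ y ∈ G.neighborFinset x, (f y * g y - f x * g x)
        - f x * ∑ y ∈ G.neighborFinset x, (g y - g x)
        - g x * ∑ y ∈ G.neighborFinset x, (f y - f x) := by
    rw [Finset.mul_sum, Finset.mul_sum, ← Finset.sum_sub_distrib, ← Finset.sum_sub_distrib]
    exact Finset.sum_congr rfl fun y _ => by ring
  rw [h, carreDuChamp, laplacian, laplacian, laplacian]
  ring

/-- A Bochner formula expressing `Γ₂(f,f)(x)` through the increments `f y - f x` on the ball of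
radius two around `x`. -/
theorem four_mul_carreDuChampTwo (f : V → ℝ) (x : V) :
    4 * G.carreDuChampTwo μ f f x
      = 1 / μ x * ∑ y ∈ G.neighborFinset x, (1 / μ y * ∑ z ∈ G.neighborFinset y,
          ((f z - f x) ^ 2 - 4 * (f y - f x) * (f z - f x) + 3 * (f y - f x) ^ 2))
        - (1 / μ x) ^ 2 * G.degree x * ∑ y ∈ G.neighborFinset x, (f y - f x) ^ 2
        + 2 * (1 / μ x) ^ 2 * (∑ y ∈ G.neighborFinset x, (f y - f x)) ^ 2 := by
  have key : ∀ y, (1 / μ y * ∑ z ∈ G.neighborFinset y,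
      ((f z - f x) ^ 2 - 4 * (f y - f x) * (f z - f x) + 3 * (f y - f x) ^ 2))
      = 2 * G.carreDuChamp μ f f y - 2 * ((f y - f x) * G.laplacian μ f y) := by
    intro y
    rw [carreDuChamp_eq_sum, laplacian]
    have : ∑ z ∈ G.neighborFinset y,
        ((f z - f x) ^ 2 - 4 * (f y - f x) * (f z - f x) + 3 * (f y - f x) ^ 2)
        = ∑ z ∈ G.neighborFinset y, (f z - f y) * (f z - f y)
          - 2 * ((f y - f x) * ∑ z ∈ G.neighborFinset y, (f z - f y)) := by
      rw [Finset.mul_sum, Finset.mul_sum, ← Finset.sum_sub_distrib]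
      exact Finset.sum_congr rfl fun z _ => by ring
    rw [this]
    ring
  have h1 : G.laplacian μ (G.carreDuChamp μ f f) x = 1 / μ x *
      (∑ y ∈ G.neighborFinset x, G.carreDuChamp μ f f y
        - G.degree x * G.carreDuChamp μ f f x) := by
    rw [laplacian, Finset.sum_sub_distrib, Finset.sum_const, card_neighborFinset_eq_degree,
      nsmul_eq_mul]
  have h2 : ∑ y ∈ G.neighborFinset x, (f y - f x) * (G.laplacian μ f y - G.laplacian μ f x)
      = ∑ y ∈ G.neighborFinset x, (f y - f x) * G.laplacian μ f y
        - (∑ y ∈ G.neighborFinset x, (f y - f x)) * G.laplacian μ f x := by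
    rw [Finset.sum_mul, ← Finset.sum_sub_distrib]
    exact Finset.sum_congr rfl fun y _ => by ring
  have h3 : G.laplacian μ f x = 1 / μ x * ∑ y ∈ G.neighborFinset x, (f y - f x) := rfl
  have h4 : G.carreDuChamp μ f f x
      = (1 / 2) * (1 / μ x * ∑ y ∈ G.neighborFinset x, (f y - f x) ^ 2) := by
    simp only [carreDuChamp_eq_sum, pow_two]
  simp only [key]
  rw [Finset.sum_sub_distrib, ← Finset.mul_sum, ← Finset.mul_sum, carreDuChampTwo, h1,
    carreDuChamp_eq_sum G μ f (G.laplacian μ f), h2, h4, h3]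
  ring

end BakryEmery

end SimpleGraph

/-! ### Reduction of Γ and Γ₂ on the antitree to sums over generations. -/

namespace Antitree

/-- The `k`-th generation of `𝒜𝒯((k))`; it is empty for `k = 0`. -/
def layer : ℕ → Finset (Vertex fun k => k)
  | 0 => ∅
  | i + 1 => Finset.univ.map ⟨fun j : Fin (i + 1) => (⟨i, j⟩ : Vertex fun k => k),
      fun _ _ h => eq_of_heq (Sigma.mk.inj h).2⟩

theorem mem_layer {k : ℕ} {x : Vertex fun k => k} :
    x ∈ layer k ↔ generation (fun k => k) x = k := by
  obtain ⟨i, j⟩ := x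
  cases k with
  | zero => exact iff_of_false (Finset.notMem_empty _) (Nat.succ_ne_zero _)
  | succ k =>
    refine Finset.mem_map.trans ⟨?_, ?_⟩
    · rintro ⟨l, -, hl⟩
      exact congrArg (fun y => Sigma.fst y + 1) hl.symm
    · intro h
      obtain rfl : i = k := Nat.succ_injective h
      exact ⟨j, Finset.mem_univ _, rfl⟩

theorem card_layer (k : ℕ) : (layer k).card = k := by
  cases k <;> simp [layer]

theorem one_le_generation (x : Vertex fun k => k) : 1 ≤ generation (fun k => k) x :=
  Nat.le_add_left _ _

theorem sum_neighborFinset {k : ℕ} {x : Vertex fun k => k}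
    (hx : generation (fun k => k) x = k) (F : Vertex (fun k => k) → ℝ) :
    ∑ y ∈ linearAntitree.neighborFinset x, F y
      = ∑ y ∈ layer (k - 1), F y + ∑ y ∈ layer k, F y + ∑ y ∈ layer (k + 1), F y - F x := by
  classical
  have hk := hx ▸ one_le_generation x
  have hd : ∀ {i j : ℕ}, i ≠ j → Disjoint (layer i) (layer j) := fun h =>
    Finset.disjoint_left.2 fun y h1 h2 => h ((mem_layer.1 h1).symm.trans (mem_layer.1 h2))
  have h : insert x (linearAntitree.neighborFinset x)
      = layer (k - 1) ∪ layer k ∪ layer (k + 1) := by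
    ext y
    simp only [Finset.mem_insert, SimpleGraph.mem_neighborFinset, Finset.mem_union, mem_layer]
    change y = x ∨ (x ≠ y ∧ _ ≤ _ ∧ _ ≤ _) ↔ _
    have hy := one_le_generation y
    by_cases hxy : y = x
    · subst hxy
      simp [hx]
    · simp only [hxy, Ne.symm hxy, false_or, ne_eq, not_false_eq_true, true_and, hx]
      omega
  rw [← Finset.sum_union (hd (by omega)), ← Finset.sum_union, ← h, Finset.sum_insert (by simp)]
  · ring
  · exact Finset.disjoint_union_left.2 ⟨hd (by omega), hd (by omega)⟩

theorem degree_eq {k : ℕ} {x : Vertex fun k => k} (hx : generation (fun k => k) x = k) :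
    (linearAntitree.degree x : ℝ) = 3 * k - 1 := by
  have hk := hx ▸ one_le_generation x
  have h := sum_neighborFinset hx (fun _ => 1)
  simp only [Finset.sum_const, SimpleGraph.card_neighborFinset_eq_degree, card_layer,
    nsmul_eq_mul, mul_one] at h
  rw [h]
  push_cast [hk]
  ring

/-- The contribution of the generation `j` to `Γ₂`, for the increment function `g`. -/
theorem sum_layer_weighted {m : ℕ → ℝ} {μ : Vertex (fun k => k) → ℝ}
    (hμ : ∀ x, μ x = m (generation (fun k => k) x)) (g : Vertex (fun k => k) → ℝ) (j : ℕ) :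
    ∑ y ∈ layer j, (1 / μ y * ∑ z ∈ linearAntitree.neighborFinset y,
        (g z ^ 2 - 4 * g y * g z + 3 * g y ^ 2))
      = 1 / m j * (j * (∑ y ∈ layer (j - 1), g y ^ 2 + ∑ y ∈ layer j, g y ^ 2
            + ∑ y ∈ layer (j + 1), g y ^ 2)
          - 4 * (∑ y ∈ layer j, g y) * (∑ y ∈ layer (j - 1), g y + ∑ y ∈ layer j, g y
            + ∑ y ∈ layer (j + 1), g y)
          + 9 * j * ∑ y ∈ layer j, g y ^ 2) := by
  have h : ∀ y ∈ layer j, (1 / μ y * ∑ z ∈ linearAntitree.neighborFinset y,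
        (g z ^ 2 - 4 * g y * g z + 3 * g y ^ 2))
      = 1 / m j * ((∑ y ∈ layer (j - 1), g y ^ 2 + ∑ y ∈ layer j, g y ^ 2
            + ∑ y ∈ layer (j + 1), g y ^ 2)
          - g y * (4 * (∑ y ∈ layer (j - 1), g y + ∑ y ∈ layer j, g y
            + ∑ y ∈ layer (j + 1), g y)) + g y ^ 2 * (9 * j)) := by
    intro y hy
    have hy' := mem_layer.1 hy
    have hd := degree_eq hy'
    rw [hμ, hy', Finset.sum_add_distrib, Finset.sum_sub_distrib, ← Finset.mul_sum,
      Finset.sum_const, SimpleGraph.card_neighborFinset_eq_degree, nsmul_eq_mul, hd,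
      sum_neighborFinset hy', sum_neighborFinset hy']
    ring
  rw [Finset.sum_congr rfl h, ← Finset.mul_sum, Finset.sum_add_distrib, Finset.sum_sub_distrib,
    ← Finset.sum_mul, ← Finset.sum_mul, Finset.sum_const, card_layer, nsmul_eq_mul]
  ring

theorem carreDuChamp_linearAntitree {m : ℕ → ℝ} {μ : Vertex (fun k => k) → ℝ}
    (hμ : ∀ x, μ x = m (generation (fun k => k) x)) (f : Vertex (fun k => k) → ℝ)
    {i : ℕ} {x : Vertex fun k => k} (hx : generation (fun k => k) x = i + 1) :
    2 * linearAntitree.carreDuChamp μ f f x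
      = 1 / m (i + 1) * (∑ y ∈ layer i, (f y - f x) ^ 2 + ∑ y ∈ layer (i + 1), (f y - f x) ^ 2
        + ∑ y ∈ layer (i + 2), (f y - f x) ^ 2) := by
  have h : ∑ y ∈ linearAntitree.neighborFinset x, (f y - f x) * (f y - f x)
      = ∑ y ∈ layer i, (f y - f x) ^ 2 + ∑ y ∈ layer (i + 1), (f y - f x) ^ 2
        + ∑ y ∈ layer (i + 2), (f y - f x) ^ 2 := by
    simp [sum_neighborFinset hx, pow_two]
  rw [SimpleGraph.carreDuChamp_eq_sum, h, hμ, hx]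
  ring

theorem carreDuChampTwo_linearAntitree {m : ℕ → ℝ} {μ : Vertex (fun k => k) → ℝ}
    (hμ : ∀ x, μ x = m (generation (fun k => k) x)) (f : Vertex (fun k => k) → ℝ)
    {i : ℕ} {x : Vertex fun k => k} (hx : generation (fun k => k) x = i + 1)
    {s t : ℕ → ℝ} (hs : ∀ j, s j = ∑ y ∈ layer j, (f y - f x))
    (ht : ∀ j, t j = ∑ y ∈ layer j, (f y - f x) ^ 2) :
    4 * linearAntitree.carreDuChampTwo μ f f x
      = 1 / m (i + 1) * (
        1 / m i * (i * (t (i - 1) + t i + t (i + 1))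
          - 4 * s i * (s (i - 1) + s i + s (i + 1)) + 9 * i * t i)
        + 1 / m (i + 1) * (i * (t i + t (i + 1) + t (i + 2))
          - 4 * s (i + 1) * (s i + s (i + 1) + s (i + 2)) + 9 * (i + 1) * t (i + 1))
        + 1 / m (i + 2) * ((i + 2) * (t (i + 1) + t (i + 2) + t (i + 3))
          - 4 * s (i + 2) * (s (i + 1) + s (i + 2) + s (i + 3)) + 9 * (i + 2) * t (i + 2))
        - 1 / m (i + 1) * (3 * i + 2) * (t i + t (i + 1) + t (i + 2))
        + 2 * (1 / m (i + 1)) * (s i + s (i + 1) + s (i + 2)) ^ 2) := by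
  -- Summing over the whole generation of `x` counts `x` itself, which is not its own neighbour.
  -- Subtracting this term turns the factor `i + 1` of the middle generation into `i`.
  have hself : 1 / μ x * ∑ z ∈ linearAntitree.neighborFinset x,
      ((f z - f x) ^ 2 - 4 * (f x - f x) * (f z - f x) + 3 * (f x - f x) ^ 2)
      = 1 / m (i + 1) * (t i + t (i + 1) + t (i + 2)) := by
    simp [sum_neighborFinset hx, hμ, hx, ht]
  have h1 : ∑ z ∈ linearAntitree.neighborFinset x, (f z - f x) = s i + s (i + 1) + s (i + 2) := by
    simp [sum_neighborFinset hx, hs]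
  have h2 : ∑ z ∈ linearAntitree.neighborFinset x, (f z - f x) ^ 2
      = t i + t (i + 1) + t (i + 2) := by
    simp [sum_neighborFinset hx, ht]
  rw [SimpleGraph.four_mul_carreDuChampTwo, h1, h2,
    sum_neighborFinset hx (fun y => 1 / μ y * ∑ z ∈ linearAntitree.neighborFinset y,
      ((f z - f x) ^ 2 - 4 * (f y - f x) * (f z - f x) + 3 * (f y - f x) ^ 2)), hself,
    sum_layer_weighted hμ (fun y => f y - f x), sum_layer_weighted hμ (fun y => f y - f x),
    sum_layer_weighted hμ (fun y => f y - f x), degree_eq hx, hμ, hx]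
  simp only [← hs, ← ht]
  simp only [Nat.add_sub_cancel, show i + 1 + 1 - 1 = i + 1 from rfl,
    show i + 1 + 1 = i + 2 from rfl, show i + 1 + 1 + 1 = i + 3 from rfl]
  push_cast
  ring

end Antitree

/-! ### Positivity of the quadratic form. -/

/-- Sylvester's criterion by completing squares, first in `a`, then in `c`, so that the determinant
is left as the coefficient of `b ^ 2`. -/
theorem ternary_form_nonneg {p q r f g h : ℝ} (hp : 0 < p) (hpr : 0 < p * r - g ^ 2)
    (hdet : 0 ≤ p * (q * r - f ^ 2) - h * (h * r - f * g) + g * (h * f - q * g)) (a b c : ℝ) :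
    0 ≤ p * a ^ 2 + q * b ^ 2 + r * c ^ 2 + 2 * h * a * b + 2 * g * a * c + 2 * f * b * c := by
  have key : p * (p * r - g ^ 2) *
      (p * a ^ 2 + q * b ^ 2 + r * c ^ 2 + 2 * h * a * b + 2 * g * a * c + 2 * f * b * c)
      = (p * r - g ^ 2) * (p * a + h * b + g * c) ^ 2
        + ((p * r - g ^ 2) * c + (p * f - h * g) * b) ^ 2
        + p * (p * (q * r - f ^ 2) - h * (h * r - f * g) + g * (h * f - q * g)) * b ^ 2 := by
    ring
  exact nonneg_of_mul_nonneg_right (key ▸ by positivity) (mul_pos hp hpr)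

namespace Antitree

/-- Positivity of the quadratic form `Γ₂` on `𝒜𝒯((k))` at a vertex of generation `n + 1 ≥ 2`, in
terms of the sums `s` and the sums of squares `t` of the increments over the generations
`n - 1, …, n + 3`; `u`, `v`, `w` are the inverse vertex measures of the three middle ones. -/
def HasFormBound (n u v w : ℝ) : Prop :=
  ∃ ε : ℝ, 0 < ε ∧ ∀ s₀ s₁ s₂ s₃ s₄ t₀ t₁ t₂ t₃ t₄ : ℝ,
    (∀ c, 0 ≤ t₀ - 2 * c * s₀ + c ^ 2 * (n - 1)) → (∀ c, 0 ≤ t₁ - 2 * c * s₁ + c ^ 2 * n) →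
    (∀ c, 0 ≤ t₂ - 2 * c * s₂ + c ^ 2 * (n + 1)) →
    (∀ c, 0 ≤ t₃ - 2 * c * s₃ + c ^ 2 * (n + 2)) →
    (∀ c, 0 ≤ t₄ - 2 * c * s₄ + c ^ 2 * (n + 3)) →
    ε * (t₁ + t₂ + t₃) ≤
      u * (n * (t₀ + t₁ + t₂) - 4 * s₁ * (s₀ + s₁ + s₂) + 9 * n * t₁)
      + v * (n * (t₁ + t₂ + t₃) - 4 * s₂ * (s₁ + s₂ + s₃) + 9 * (n + 1) * t₂)
      + w * ((n + 2) * (t₂ + t₃ + t₄) - 4 * s₃ * (s₂ + s₃ + s₄) + 9 * (n + 2) * t₃)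
      - v * (3 * n + 2) * (t₁ + t₂ + t₃) + 2 * v * (s₁ + s₂ + s₃) ^ 2

/-- The quantities in `hα`, `hβ`, `hγ` are the coefficients of `t₁`, `t₂`, `t₃`. Once all `tⱼ` and
the outer sums are eliminated, `p`, `q`, `r` are the diagonal coefficients of the form in `s₁`,
`s₂`, `s₃`; its off-diagonal ones are `-2u`, `2v`, `-2w`. -/
theorem hasFormBound_of_minors {n u v w : ℝ} (hn : 1 ≤ n) (hu : 0 < u) (hw : 0 < w)
    {p q r : ℝ}
    (hα : 0 < 10 * u * n - 2 * v * (n + 1))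
    (hβ : 0 < u * n + w * (n + 2) + 7 * v * (n + 1))
    (hγ : 0 < 10 * w * (n + 2) - 2 * v * (n + 1))
    (hp : p = (10 * u * n - 2 * v * (n + 1)) / n - 4 * u - 4 * u * (n - 1) / n + 2 * v)
    (hq : q = (u * n + w * (n + 2) + 7 * v * (n + 1)) / (n + 1) - 2 * v)
    (hr : r = (10 * w * (n + 2) - 2 * v * (n + 1)) / (n + 2) - 4 * w
      - 4 * w * (n + 3) / (n + 2) + 2 * v)
    (hp0 : 0 < p) (hpr : 0 < p * r - (2 * v) ^ 2)
    (hdet : 0 < p * (q * r - (-2 * w) ^ 2) - (-2 * u) * ((-2 * u) * r - (-2 * w) * (2 * v))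
      + 2 * v * ((-2 * u) * (-2 * w) - q * (2 * v))) :
    HasFormBound n u v w := by
  -- All six conditions are strict at `ε = 0` and continuous in `ε`, so they survive together for
  -- some small `ε > 0`.
  have hev : ∀ {F : ℝ → ℝ}, Continuous F → 0 < F 0 → ∀ᶠ ε in nhdsWithin 0 (Set.Ioi 0), 0 < F ε :=
    fun hF h0 => ((hF.tendsto 0).eventually (lt_mem_nhds h0)).filter_mono nhdsWithin_le_nhds
  obtain ⟨ε, hε, h1, h2, h3, h4, h5, h6⟩ := (eventually_mem_nhdsWithin.and
    ((hev (F := fun ε => 10 * u * n - 2 * v * (n + 1) - ε) (by fun_prop) (by simpa using hα)).and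
    ((hev (F := fun ε => u * n + w * (n + 2) + 7 * v * (n + 1) - ε) (by fun_prop)
      (by simpa using hβ)).and
    ((hev (F := fun ε => 10 * w * (n + 2) - 2 * v * (n + 1) - ε) (by fun_prop)
      (by simpa using hγ)).and
    ((hev (F := fun ε => p - ε / n) (by fun_prop) (by simpa using hp0)).and
    ((hev (F := fun ε => (p - ε / n) * (r - ε / (n + 2)) - (2 * v) ^ 2) (by fun_prop)
      (by simpa using hpr)).and
    (hev (F := fun ε => (p - ε / n) * ((q - ε / (n + 1)) * (r - ε / (n + 2)) - (-2 * w) ^ 2)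
      - (-2 * u) * ((-2 * u) * (r - ε / (n + 2)) - (-2 * w) * (2 * v))
      + 2 * v * ((-2 * u) * (-2 * w) - (q - ε / (n + 1)) * (2 * v))) (by fun_prop)
      (by simpa using hdet)))))))).exists
  refine ⟨ε, hε, fun s₀ s₁ s₂ s₃ s₄ t₀ t₁ t₂ t₃ t₄ g₀ g₁ g₂ g₃ g₄ => ?_⟩
  have hform := ternary_form_nonneg h4 h5 h6.le s₁ s₂ s₃
  have hn0 : n ≠ 0 := by positivity
  have hn1 : n + 1 ≠ 0 := by positivity
  have hn2 : n + 2 ≠ 0 := by positivity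
  -- In `e0` and `e4` the choice of `c` reproduces the cross terms `-4 u s₀ s₁` and `-4 w s₃ s₄`. In
  -- `e1`, `e2`, `e3`, `c` is the mean over the generation, which is the Cauchy–Schwarz bound.
  have e0 := mul_nonneg (mul_pos hu (by positivity : 0 < n)).le (g₀ (2 * s₁ / n))
  have e1 := mul_nonneg h1.le (g₁ (s₁ / n))
  have e2 := mul_nonneg h2.le (g₂ (s₂ / (n + 1)))
  have e3 := mul_nonneg h3.le (g₃ (s₃ / (n + 2)))
  have e4 := mul_nonneg (mul_pos hw (by positivity : 0 < n + 2)).le (g₄ (2 * s₃ / (n + 2)))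
  rw [← sub_nonneg]
  refine (add_nonneg (add_nonneg (add_nonneg (add_nonneg (add_nonneg hform e0) e1) e2) e3)
    e4).trans_eq ?_
  rw [hp, hq, hr]
  field_simp
  ring

theorem hasFormBound_nonNormalized {n : ℝ} (hn : 1 ≤ n) :
    HasFormBound n 1 1 1 := by
  -- After this shift the remaining polynomials have nonnegative coefficients in `x ≥ 0`, within
  -- reach of `positivity`.
  obtain ⟨x, rfl⟩ : ∃ x, n = x + 1 := ⟨n - 1, by ring⟩
  have hx : 0 ≤ x := by linarith
  refine hasFormBound_of_minors (u := 1) (v := 1) (w := 1) (p := 2 * (x + 2) / (x + 1)) (q := 7)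
    (r := 2 * (x + 2) / (x + 3)) hn one_pos one_pos (by nlinarith) (by nlinarith) (by nlinarith)
    ?_ ?_ ?_ (by positivity) ?_ ?_
  · field_simp
    ring
  · field_simp
    ring
  · field_simp
    ring
  · have : 2 * (x + 2) / (x + 1) * (2 * (x + 2) / (x + 3)) - (2 * 1) ^ 2
        = 4 / ((x + 1) * (x + 3)) := by
      field_simp
      ring
    rw [this]
    positivity
  · rw [← sub_pos]
    field_simp
    ring_nf
    positivity

theorem hasFormBound_normalized {n : ℝ} (hn : 1 ≤ n) :
    HasFormBound n (1 / (3 * n - 1)) (1 / (3 * n + 2)) (1 / (3 * n + 5)) := by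
  obtain ⟨x, rfl⟩ : ∃ x, n = x + 1 := ⟨n - 1, by ring⟩
  have hx : 0 ≤ x := by linarith
  rw [show 3 * (x + 1) - 1 = 3 * x + 2 by ring, show 3 * (x + 1) + 2 = 3 * x + 5 by ring,
    show 3 * (x + 1) + 5 = 3 * x + 8 by ring]
  have hα : 10 * (1 / (3 * x + 2)) * (x + 1) - 2 * (1 / (3 * x + 5)) * (x + 1 + 1)
      = (24 * x ^ 2 + 64 * x + 42) / ((3 * x + 2) * (3 * x + 5)) := by
    field_simp
    ring
  have hγ : 10 * (1 / (3 * x + 8)) * (x + 1 + 2) - 2 * (1 / (3 * x + 5)) * (x + 1 + 1)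
      = (24 * x ^ 2 + 112 * x + 118) / ((3 * x + 8) * (3 * x + 5)) := by
    field_simp
    ring
  refine hasFormBound_of_minors (u := 1 / (3 * x + 2)) (v := 1 / (3 * x + 5)) (w := 1 / (3 * x + 8))
    (p := (6 * x ^ 2 + 22 * x + 26) / ((x + 1) * (3 * x + 2) * (3 * x + 5))) hn
    (by positivity) (by positivity) (by rw [hα]; positivity) (by positivity)
    (by rw [hγ]; positivity) ?_ rfl rfl (by positivity) ?_ ?_
  · field_simp
    ring
  · rw [← sub_pos]
    field_simp
    ring_nf
    positivity
  · rw [← sub_pos]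
    field_simp
    ring_nf
    positivity

end Antitree

/-! ### Positive curvature at every vertex. -/

namespace Antitree

theorem sum_sq_sub_const_nonneg (g : Vertex (fun k => k) → ℝ) (j : ℕ) (c : ℝ) :
    0 ≤ ∑ y ∈ layer j, g y ^ 2 - 2 * c * ∑ y ∈ layer j, g y + c ^ 2 * j := by
  have h : ∑ y ∈ layer j, (g y - c) ^ 2
      = ∑ y ∈ layer j, g y ^ 2 - 2 * c * ∑ y ∈ layer j, g y + c ^ 2 * j := by
    have h' : c ^ 2 * j = ∑ _y ∈ layer j, c ^ 2 := by
      rw [Finset.sum_const, card_layer, nsmul_eq_mul, mul_comm]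
    rw [h', Finset.mul_sum, ← Finset.sum_sub_distrib, ← Finset.sum_add_distrib]
    exact Finset.sum_congr rfl fun y _ => by ring
  exact h ▸ Finset.sum_nonneg fun y _ => sq_nonneg _

theorem exists_curvatureDimensionAt_succ {m : ℕ → ℝ} {μ : Vertex (fun k => k) → ℝ}
    (hμ : ∀ x, μ x = m (generation (fun k => k) x)) {i : ℕ} (hi : 1 ≤ i) (hm : 0 < m (i + 1))
    (hb : HasFormBound i (1 / m i) (1 / m (i + 1)) (1 / m (i + 2))) :
    ∃ K : ℝ, 0 < K ∧ ∀ x, generation (fun k => k) x = i + 1 →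
      linearAntitree.CurvatureDimensionAt μ K ⊤ x := by
  obtain ⟨ε, hε, h⟩ := hb
  refine ⟨ε / 2, half_pos hε, fun x hx f => ?_⟩
  have h1 := carreDuChamp_linearAntitree hμ f hx
  have h2 := carreDuChampTwo_linearAntitree hμ f hx (fun j => rfl) (fun j => rfl)
  have hv := sum_sq_sub_const_nonneg fun y => f y - f x
  have h3 := mul_le_mul_of_nonneg_left (h _ _ _ _ _ _ _ _ _ _
    (fun c => by simpa only [Nat.cast_pred hi] using hv (i - 1) c) (hv i) (fun c => by simpa only [Nat.cast_add, Nat.cast_ofNat, Nat.cast_one] using hv (i + 1) c)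
    (fun c => by simpa only [Nat.cast_add, Nat.cast_ofNat, Nat.cast_one] using hv (i + 2) c) (fun c => by simpa only [Nat.cast_add, Nat.cast_ofNat, Nat.cast_one] using hv (i + 3) c))
    (one_div_pos.2 hm).le
  have h4 : 1 / m (i + 1) * (ε * (∑ y ∈ layer i, (f y - f x) ^ 2
      + ∑ y ∈ layer (i + 1), (f y - f x) ^ 2 + ∑ y ∈ layer (i + 2), (f y - f x) ^ 2))
      = ε * (2 * linearAntitree.carreDuChamp μ f f x) := by
    rw [h1]
    ring
  rw [h4, ← h2] at h3
  simp only [ENNReal.inv_top, ENNReal.toReal_zero, zero_mul, add_zero]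
  linarith

/-- At the root, generation 0 is empty and generation 1 is `{x}`, so only the sums over generations
2 and 3 remain. The value `m 0` drops out. -/
theorem curvatureDimensionAt_one {m : ℕ → ℝ} {μ : Vertex (fun k => k) → ℝ}
    (hμ : ∀ x, μ x = m (generation (fun k => k) x)) (hm1 : 0 < m 1) (hm2 : 0 < m 2)
    (h : 2 * (1 / m 1) ≤ 10 * (1 / m 2))
    {x : Vertex fun k => k} (hx : generation (fun k => k) x = 1) :
    linearAntitree.CurvatureDimensionAt μ (1 / m 1) ⊤ x := by
  intro f
  have h1 := carreDuChamp_linearAntitree hμ f hx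
  have h2 := carreDuChampTwo_linearAntitree hμ f hx (fun j => rfl) (fun j => rfl)
  have hv := sum_sq_sub_const_nonneg fun y => f y - f x
  have hl : layer 1 = {x} :=
    (Finset.eq_of_subset_of_card_le (Finset.singleton_subset_iff.2 (mem_layer.2 hx))
      (by rw [card_layer, Finset.card_singleton])).symm
  -- The mean of generation 2 gives Cauchy–Schwarz there; `c = s₂` on generation 3 absorbs the cross
  -- term `s₂ s₃`.
  have e1 := hv 2 ((∑ y ∈ layer 2, (f y - f x)) / 2)
  have e2 := hv 3 (∑ y ∈ layer 2, (f y - f x))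
  simp only [hl, show layer 0 = ∅ from rfl, zero_add, Nat.zero_sub, Finset.sum_empty,
    Finset.sum_singleton, sub_self, Nat.cast_zero, Nat.cast_ofNat] at h1 h2 e1 e2
  generalize ∑ y ∈ layer 2, (f y - f x) = s₂ at *
  generalize ∑ y ∈ layer 2, (f y - f x) ^ 2 = t₂ at *
  generalize ∑ y ∈ layer 3, (f y - f x) = s₃ at *
  generalize ∑ y ∈ layer 3, (f y - f x) ^ 2 = t₃ at *
  have hv0 : 0 < 1 / m 1 := one_div_pos.2 hm1
  have hw0 : 0 < 1 / m 2 := one_div_pos.2 hm2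
  generalize 1 / m 1 = v at *
  generalize 1 / m 2 = w at *
  simp only [ENNReal.inv_top, ENNReal.toReal_zero, zero_mul, add_zero]
  have ht : 0 ≤ 2 * t₂ - s₂ ^ 2 := by linarith
  have e3 := mul_nonneg hv0.le (mul_nonneg hw0.le e2)
  have e4 := mul_nonneg hv0.le (mul_nonneg (sub_nonneg.2 h) ht)
  linear_combination v * h1 / 2 - h2 / 4 + e3 / 2 + e4 / 4

/-! ### Decay of the curvature, tested on the generation function. -/

theorem carreDuChamp_generation {m : ℕ → ℝ} {μ : Vertex (fun k => k) → ℝ}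
    (hμ : ∀ x, μ x = m (generation (fun k => k) x)) {n : ℕ}
    {x : Vertex fun k => k} (hx : generation (fun k => k) x = n + 2) :
    linearAntitree.carreDuChamp μ (fun y => (generation (fun k => k) y : ℝ))
        (fun y => (generation (fun k => k) y : ℝ)) x = 1 / m (n + 2) * (n + 2) ∧
      4 * linearAntitree.carreDuChampTwo μ (fun y => (generation (fun k => k) y : ℝ))
        (fun y => (generation (fun k => k) y : ℝ)) x
        = 1 / m (n + 2) * (2 * (n + 1) * (n + 3) * (1 / m (n + 1) + 1 / m (n + 3))
          + (8 - 4 * (n + 2) ^ 2) * (1 / m (n + 2))) := by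
  have h1 := carreDuChamp_linearAntitree hμ (fun y => (generation (fun k => k) y : ℝ)) hx
  have hs : ∀ j : ℕ, (j * ((j : ℝ) - (n + 2)))
      = ∑ y ∈ layer j, ((generation (fun k => k) y : ℝ) - generation (fun k => k) x) := by
    intro j
    rw [Finset.sum_congr rfl fun y hy => by rw [mem_layer.1 hy, hx], Finset.sum_const, card_layer,
      nsmul_eq_mul]
    push_cast
    ring
  have ht : ∀ j : ℕ, (j * ((j : ℝ) - (n + 2)) ^ 2)
      = ∑ y ∈ layer j, ((generation (fun k => k) y : ℝ) - generation (fun k => k) x) ^ 2 := by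
    intro j
    rw [Finset.sum_congr rfl fun y hy => by rw [mem_layer.1 hy, hx], Finset.sum_const, card_layer,
      nsmul_eq_mul]
    push_cast
    ring
  have h2 := carreDuChampTwo_linearAntitree hμ (fun y => (generation (fun k => k) y : ℝ)) hx hs ht
  simp only [← ht] at h1
  simp only [Nat.add_sub_cancel, show n + 1 + 1 = n + 2 from rfl, show n + 1 + 2 = n + 3 from rfl,
    show n + 1 + 3 = n + 4 from rfl, Nat.cast_add, Nat.cast_ofNat, Nat.cast_one] at h1 h2
  constructor
  · linear_combination h1 / 2
  · rw [h2]
    ring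

/-- The condition `hb` says exactly that Γ₂ ≤ 1/μ for the generation function, whose Γ is k/μ at
generation `k = n + 2`. For `μ ≡ 1` it is an equality. -/
theorem le_inv_generation_of_curvatureDimensionAt {m : ℕ → ℝ} {μ : Vertex (fun k => k) → ℝ}
    (hμ : ∀ x, μ x = m (generation (fun k => k) x)) {n : ℕ} {K : ℝ}
    {x : Vertex fun k => k} (hx : generation (fun k => k) x = n + 2) (hm : 0 < m (n + 2))
    (hb : 2 * (n + 1) * (n + 3) * (1 / m (n + 1) + 1 / m (n + 3))
      + (8 - 4 * (n + 2) ^ 2) * (1 / m (n + 2)) ≤ 4)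
    (h : linearAntitree.CurvatureDimensionAt μ K ⊤ x) :
    K ≤ 1 / (generation (fun k => k) x : ℝ) := by
  obtain ⟨h1, h2⟩ := carreDuChamp_generation hμ hx
  have h3 := h (fun y => (generation (fun k => k) y : ℝ))
  simp only [ENNReal.inv_top, ENNReal.toReal_zero, zero_mul, add_zero, h1] at h3
  have h4 := mul_le_mul_of_nonneg_left hb (one_div_pos.2 hm).le
  have h5 : 1 / m (n + 2) * (K * (n + 2)) ≤ 1 / m (n + 2) * 1 := by linarith
  rw [hx, le_div_iff₀ (by positivity)]
  exact_mod_cast le_of_mul_le_mul_left h5 (one_div_pos.2 hm)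

theorem comap_generation_neBot :
    (Filter.comap (generation (fun k => k)) Filter.atTop).NeBot := by
  refine Filter.NeBot.comap_of_range_mem inferInstance ?_
  filter_upwards [Filter.eventually_ge_atTop 1] with k hk
  exact ⟨⟨k - 1, ⟨0, Nat.succ_pos _⟩⟩, Nat.sub_add_cancel hk⟩

theorem liminf_eq_zero_of_le_inv_generation {K : Vertex (fun k => k) → ℝ} (hK : ∀ x, 0 < K x)
    (h : ∀ x, 2 ≤ generation (fun k => k) x → K x ≤ 1 / (generation (fun k => k) x : ℝ)) :
    Filter.liminf (fun x => (K x : EReal))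
      (Filter.comap (generation (fun k => k)) Filter.atTop) = 0 := by
  have := comap_generation_neBot
  have hlim : Filter.Tendsto K (Filter.comap (generation (fun k => k)) Filter.atTop) (nhds 0) :=
    squeeze_zero' (Filter.Eventually.of_forall fun x => (hK x).le)
      ((Filter.tendsto_comap.eventually (Filter.eventually_ge_atTop 2)).mono h)
      (tendsto_one_div_atTop_nhds_zero_nat.comp Filter.tendsto_comap)
  exact (EReal.tendsto_coe.2 hlim).liminf_eq

/-- Both conclusions for a vertex measure that depends only on the generation, under numerical
conditions on it. -/
theorem curvature_of_generation_measure {m : ℕ → ℝ} {μ : Vertex (fun k => k) → ℝ}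
    (hμ : ∀ x, μ x = m (generation (fun k => k) x)) (hm : ∀ k, 1 ≤ k → 0 < m k)
    (h1 : 2 * (1 / m 1) ≤ 10 * (1 / m 2))
    (h2 : ∀ i : ℕ, 1 ≤ i → HasFormBound i (1 / m i) (1 / m (i + 1)) (1 / m (i + 2)))
    (h3 : ∀ n : ℕ, 2 * (n + 1) * (n + 3) * (1 / m (n + 1) + 1 / m (n + 3))
      + (8 - 4 * (n + 2) ^ 2) * (1 / m (n + 2)) ≤ 4) :
    (∃ K : ℕ → ℝ, (∀ k : ℕ, 1 ≤ k → 0 < K k) ∧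
      ∀ x, linearAntitree.CurvatureDimensionAt μ (K (generation (fun k => k) x)) ⊤ x) ∧
    (∀ K : Vertex (fun k => k) → ℝ, (∀ x, 0 < K x) →
      (∀ x, linearAntitree.CurvatureDimensionAt μ (K x) ⊤ x) →
      Filter.liminf (fun x => (K x : EReal))
        (Filter.comap (generation (fun k => k)) Filter.atTop) = 0) := by
  constructor
  · have hex : ∀ k : ℕ, ∃ K : ℝ, 0 < K ∧ ∀ x, generation (fun k => k) x = k →
        linearAntitree.CurvatureDimensionAt μ K ⊤ x := by
      intro k
      rcases k with _ | _ | k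
      · exact ⟨1, one_pos, fun x hx => absurd hx (Nat.succ_ne_zero _)⟩
      · exact ⟨1 / m 1, one_div_pos.2 (hm 1 le_rfl), fun x hx =>
          curvatureDimensionAt_one hμ (hm 1 le_rfl) (hm 2 one_le_two) h1 hx⟩
      · exact exists_curvatureDimensionAt_succ hμ (Nat.le_add_left 1 k)
          (hm _ (Nat.le_add_left 1 _)) (h2 _ (Nat.le_add_left 1 k))
    choose K hK hCD using hex
    exact ⟨K, fun k _ => hK k, fun x => hCD _ x rfl⟩
  · intro K hK hCD
    refine liminf_eq_zero_of_le_inv_generation hK fun x hx => ?_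
    obtain ⟨n, hn⟩ := Nat.exists_eq_add_of_le' hx
    exact le_inv_generation_of_curvatureDimensionAt hμ hn (hm _ (Nat.le_add_left 1 _)) (h3 n)
      (hCD x)

end Antitree

theorem mainTheorem1 (μ : Antitree.Vertex (fun k => k) → ℝ)
    (hμ : μ = linearAntitree.nonNormalizedMeasure ∨ μ = linearAntitree.normalizedMeasure) :
    (∃ K : ℕ → ℝ, (∀ k : ℕ, 1 ≤ k → 0 < K k) ∧
      ∀ x : Antitree.Vertex (fun k => k),
        linearAntitree.CurvatureDimensionAt μ (K (Antitree.generation (fun k => k) x)) ⊤ x) ∧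
    (∀ K : Antitree.Vertex (fun k => k) → ℝ,
      (∀ x, 0 < K x) →
      (∀ x, linearAntitree.CurvatureDimensionAt μ (K x) ⊤ x) →
      Filter.liminf (fun x => (K x : EReal))
        (Filter.comap (Antitree.generation (fun k => k)) Filter.atTop) = 0) := by
  rcases hμ with rfl | rfl
  · refine Antitree.curvature_of_generation_measure (m := fun _ => 1) (fun x => rfl)
      (fun _ _ => one_pos) (by norm_num) (fun i hi => ?_) (fun n => ?_)
    · simpa only [div_one] using
        Antitree.hasFormBound_nonNormalized (n := i) (by exact_mod_cast hi)
    · exact le_of_eq (by ring)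
  -- The negative value `m 0 = -1` is harmless, since generation 0 is empty and positivity is
  -- required only from generation 1 on.
  · refine Antitree.curvature_of_generation_measure (m := fun k => 3 * k - 1)
      (fun x => Antitree.degree_eq rfl) (fun k hk => ?_) (by norm_num) (fun i hi => ?_)
      (fun n => ?_)
    · have : (1 : ℝ) ≤ k := by exact_mod_cast hk
      linarith
    · convert Antitree.hasFormBound_normalized (n := i) (by exact_mod_cast hi) using 2
      · push_cast
        ring
      · push_cast
        ring
    · have e1 : 3 * ((n + 1 : ℕ) : ℝ) - 1 = 3 * n + 2 := by push_cast; ring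
      have e2 : 3 * ((n + 2 : ℕ) : ℝ) - 1 = 3 * n + 5 := by push_cast; ring
      have e3 : 3 * ((n + 3 : ℕ) : ℝ) - 1 = 3 * n + 8 := by push_cast; ring
      rw [e1, e2, e3, ← sub_nonneg]
      field_simp
      ring_nf
      positivity
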